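/- Conventions. For a real vector space $V$ with an antisymmetric bilinear form $\sigma$, let $\mathrm{CCR}(V,\sigma)$ be the universal unital $C^*$-algebra generated by elements $W(x)$, $x\in V$, subject to $W(x)^*=W(-x)$ and $W(x)W(y)=e^{i\sigma(x,y)}W(x+y)$, with unit $W(0)$. Let $\mathcal H$ be a complex Hilbert space with an orthonormal basis $(e_k)_{k\in\mathbb Z}$, regarded as a real symplectic space with $\sigma(x,y)=\operatorname{Im}\langle x,y\rangle$ (inner product linear in the first variable), and let $\mathfrak A=\mathrm{CCR}(\mathbb C,\sigma)$ with $\sigma(z,w)=\operatorname{Im}z\bar w$. Let $\mathfrak B_0\subset\mathrm{CCR}(\mathcal H,\sigma)$ be the norm closure of $\bigcup_n\mathfrak B_n$, where $\mathfrak B_n$ is the $C^*$-subalgebra generated by the $W(x)$ with $x\in\operatorname{span}_{\mathbb C}\{e_k:|k|\le n\}$. For $k\in\mathbb Z$ let $i_k:\mathfrak A\to\mathfrak B_0$ be the unital $*$-homomorphism with $i_k(W(z))=W(ze_k)$; through these, $\mathfrak B_0\cong\bigotimes_{\mathbb Z}\mathfrak A$. For a state $\varphi$ on $\mathfrak A$,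 the product state $\bigotimes_{\mathbb Z}\varphi$ is the state $\omega$ on $\mathfrak B_0$ with $\omega(i_{k_1}(a_1)\cdots i_{k_n}(a_n))=\varphi(a_1)\cdots\varphi(a_n)$ for all distinct $k_1,\dots,k_n\in\mathbb Z$ and $a_1,\dots,a_n\in\mathfrak A$. Let $\mathbb U_{\mathbb Z}$ be the group of unitaries $U$ of $\mathcal H$ for which there is $N$ with $Ue_k=e_k$ for all $|k|>N$; it acts on $\mathfrak B_0$ by $*$-automorphisms $\rho_U$ with $\rho_U(W(x))=W(Ux)$. A state $\omega$ on $\mathfrak B_0$ is $\mathbb U_{\mathbb Z}$-invariant if $\omega\circ\rho_U=\omega$ for all $U\in\mathbb U_{\mathbb Z}$. Proposition. Let $\varphi$ be a state on $\mathfrak A$ such that the product state $\bigotimes_{\mathbb Z}\varphi$ on $\mathfrak B_0$ is $\mathbb U_{\mathbb Z}$-invariant. Then the characteristic function $G_\varphi:\mathbb C\to\mathbb C$, $G_\varphi(z)=\varphi(W(z))$, is either the indicator function of $\{0\}$, or there is a real constant $\sigma^2\ge 1$ such that $G_\varphi(z)=e^{-\sigma^2|z|^2/2}$ for all $z\in\mathbb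 C$. -/

import Mathlib

universe u v v' w

noncomputable section

open scoped ENNReal ComplexOrder

namespace CCRAlg

/-! ### The universal C⋆-algebra of the canonical commutation relations -/

section Weyl

variable {V : Type v} [AddCommGroup V] [Module ℝ V]
variable {V' : Type v'} [AddCommGroup V'] [Module ℝ V']

/-- A (nonzero) unital C⋆-algebra together with a family of elements `W x`, `x ∈ V`, satisfying the
canonical commutation relations in Weyl form for the (antisymmetric) real bilinear form `σ`;
the unit of the algebra is `W 0`. -/
structure WeylSystem (σ : LinearMap.BilinForm ℝ V) where
  /-- the underlying C⋆-algebra -/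
  carrier : Type w
  [cstar : CStarAlgebra carrier]
  [nontrivial : Nontrivial carrier]
  /-- the Weyl elements -/
  W : V → carrier
  W_zero : W 0 = 1
  star_W : ∀ x, star (W x) = W (-x)
  W_mul : ∀ x y, W x * W y = Complex.exp (Complex.I * (σ x y : ℂ)) • W (x + y)

attribute [instance] WeylSystem.cstar WeylSystem.nontrivial

/-- The Weyl system `x ↦ W (T x)` obtained by precomposing with a real linear map `T` which
intertwines the forms. -/
@[simps carrier W]
def WeylSystem.comp {σ : LinearMap.BilinForm ℝ V} {σ' : LinearMap.BilinForm ℝ V'}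
    (S : WeylSystem.{v', w} σ') (T : V →ₗ[ℝ] V') (hT : ∀ x y, σ' (T x) (T y) = σ x y) :
    WeylSystem.{v, w} σ where
  carrier := S.carrier
  W x := S.W (T x)
  W_zero := by simp [S.W_zero]
  star_W x := by simp [S.star_W]
  W_mul x y := by simp [S.W_mul, hT]

theorem WeylSystem.norm_W_le {σ : LinearMap.BilinForm ℝ V} (S : WeylSystem.{v, w} σ) (x : V) :
    ‖S.W x‖ ≤ 1 := by
  have h : ‖star (S.W x) * S.W x‖ = 1 := by
    rw [S.star_W, S.W_mul, neg_add_cancel, S.W_zero, norm_smul, norm_one, mul_one,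
      mul_comm, Complex.norm_exp_ofReal_mul_I]
  rw [CStarRing.norm_star_mul_self] at h
  nlinarith [norm_nonneg (S.W x)]

variable (σ : LinearMap.BilinForm ℝ V)

/-- The C⋆-algebra of all bounded families indexed by all Weyl systems over `σ`. -/
def Ambient : Type (max v (w + 1)) :=
  ↥(lp (fun S : WeylSystem.{v, w} σ => S.carrier) ∞)

instance : CStarAlgebra ↥(lp (fun S : WeylSystem.{v, w} σ => S.carrier) ∞) where

instance : CStarAlgebra (Ambient.{v, w} σ) :=
  inferInstanceAs (CStarAlgebra ↥(lp (fun S : WeylSystem.{v, w} σ => S.carrier) ∞))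

/-- The family of the Weyl elements at `x` of all Weyl systems. -/
def ambientW (x : V) : Ambient.{v, w} σ :=
  ⟨fun S => S.W x, memℓp_infty ⟨1, by rintro _ ⟨S, rfl⟩; exact S.norm_W_le x⟩⟩

/-- The closed unital ⋆-subalgebra generated by the universal Weyl elements. -/
def ccrSubalgebra : StarSubalgebra ℂ (Ambient.{v, w} σ) :=
  (StarAlgebra.adjoin ℂ (Set.range (ambientW.{v, w} σ))).topologicalClosure

instance : IsClosed (ccrSubalgebra.{v, w} σ : Set (Ambient.{v, w} σ)) :=
  StarSubalgebra.isClosed_topologicalClosure _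

/-- `CCR(V, σ)`: the universal C⋆-algebra generated by elements `W x`, `x ∈ V`, satisfying the Weyl
relations, realized inside the product of all C⋆-algebras (in the universe `w`, at least that
of `V`) carrying such elements. Its norm is the largest C⋆-norm compatible with the relations. -/
def CCR : Type (max v (w + 1)) := ↥(ccrSubalgebra.{v, w} σ)

instance : CStarAlgebra (CCR.{v, w} σ) :=
  inferInstanceAs (CStarAlgebra ↥(ccrSubalgebra.{v, w} σ))

/-- The inclusion of `CCR(V, σ)` into the product of all Weyl systems. -/
def CCR.incl : CCR.{v, w} σ →⋆ₐ[ℂ] Ambient.{v, w} σ := (ccrSubalgebra.{v, w} σ).subtype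

namespace CCR

/-- The Weyl elements of `CCR(V, σ)`. -/
def W (x : V) : CCR.{v, w} σ :=
  ⟨ambientW σ x, StarSubalgebra.le_topologicalClosure _
    (StarAlgebra.subset_adjoin ℂ _ (Set.mem_range_self x))⟩

theorem W_zero : W.{v, w} σ 0 = 1 :=
  Subtype.ext (lp.ext (funext fun S => S.W_zero))

theorem star_W (x : V) : star (W.{v, w} σ x) = W σ (-x) :=
  Subtype.ext (lp.ext (funext fun S => S.star_W x))

theorem W_mul (x y : V) :
    W.{v, w} σ x * W σ y = Complex.exp (Complex.I * (σ x y : ℂ)) • W σ (x + y) :=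
  Subtype.ext (lp.ext (funext fun S => S.W_mul x y))

end CCR

/-- Evaluation of a bounded family at the Weyl system `S`. -/
def ambientEval (S : WeylSystem.{v, w} σ) : Ambient.{v, w} σ →⋆ₐ[ℂ] S.carrier where
  toFun a := a.1 S
  map_one' := rfl
  map_mul' _ _ := rfl
  map_zero' := rfl
  map_add' _ _ := rfl
  commutes' _ := rfl
  map_star' _ := rfl

/-- A closed ⋆-subalgebra of `CCR(V, σ)` which contains the Weyl elements is everything. -/
theorem CCR.mem_of_W {σ : LinearMap.BilinForm ℝ V} {S : StarSubalgebra ℂ (CCR.{v, w} σ)}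
    (hS : IsClosed (S : Set (CCR.{v, w} σ))) (h : ∀ x, CCR.W σ x ∈ S) (a : CCR.{v, w} σ) :
    a ∈ S := by
  have hd : DenseRange (Set.inclusion (StarSubalgebra.le_topologicalClosure
      (StarAlgebra.adjoin ℂ (Set.range (ambientW.{v, w} σ))))) :=
    (denseRange_inclusion_iff _).2 (StarSubalgebra.topologicalClosure_coe _).le
  have hr : ∀ y : StarAlgebra.adjoin ℂ (Set.range (ambientW.{v, w} σ)),
      StarSubalgebra.inclusion (StarSubalgebra.le_topologicalClosure _) y ∈ S := by
    intro y
    induction y using StarAlgebra.adjoin_induction_subtype with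
    | mem y hy => obtain ⟨x, rfl⟩ := hy; exact h x
    | algebraMap r => exact S.algebraMap_mem r
    | add x y hx hy => exact add_mem hx hy
    | mul x y hx hy => exact mul_mem hx hy
    | star x hx => exact (star_mem hx : star (_ : CCR.{v, w} σ) ∈ S)
  exact hd.induction_on (p := fun a => a ∈ S) a hS hr

/-- Two ⋆-homomorphisms on `CCR(V, σ)` which agree on the Weyl elements are equal. -/
theorem CCR.hom_ext {B : Type*} [CStarAlgebra B] {f g : CCR.{v, w} σ →⋆ₐ[ℂ] B}
    (h : ∀ x, f (CCR.W σ x) = g (CCR.W σ x)) : f = g := by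
  have hf : Continuous f := (NonUnitalStarAlgHom.instContinuousLinearMapClassComplex.map_continuous f)
  have hg : Continuous g := (NonUnitalStarAlgHom.instContinuousLinearMapClassComplex.map_continuous g)
  refine StarAlgHom.ext_topologicalClosure hf hg ?_
  refine StarAlgHom.ext_adjoin ?_
  rintro ⟨_, _⟩ ⟨x, rfl⟩
  exact h x

/-- The universal property of `CCR(V, σ)`. -/
theorem CCR.existsUnique_hom (S : WeylSystem.{v, w} σ) :
    ∃! f : CCR.{v, w} σ →⋆ₐ[ℂ] S.carrier, ∀ x, f (CCR.W σ x) = S.W x :=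
  ⟨(ambientEval σ S).comp (CCR.incl σ), fun _ => rfl,
    fun _ hg => CCR.hom_ext σ fun x => hg x⟩

variable {σ}
variable {σ' : LinearMap.BilinForm ℝ V'}

/-- Reindexing of bounded families along `WeylSystem.comp`. -/
def ambientMap (T : V →ₗ[ℝ] V') (hT : ∀ x y, σ' (T x) (T y) = σ x y) :
    Ambient.{v, w} σ →⋆ₐ[ℂ] Ambient.{v', w} σ' where
  toFun a := ⟨fun S => a.1 (S.comp T hT), memℓp_infty ⟨‖a‖, by
    rintro _ ⟨S, rfl⟩; exact lp.norm_apply_le_norm ENNReal.top_ne_zero a (S.comp T hT)⟩⟩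
  map_one' := rfl
  map_mul' _ _ := rfl
  map_zero' := rfl
  map_add' _ _ := rfl
  commutes' _ := rfl
  map_star' _ := rfl

theorem ambientMap_mem (T : V →ₗ[ℝ] V') (hT : ∀ x y, σ' (T x) (T y) = σ x y)
    (a : CCR.{v, w} σ) : ambientMap T hT (CCR.incl σ a) ∈ ccrSubalgebra.{v', w} σ' := by
  have hc : Continuous (ambientMap.{v, v', w} T hT) :=
    NonUnitalStarAlgHom.instContinuousLinearMapClassComplex.map_continuous _
  have hle : ccrSubalgebra.{v, w} σ ≤ (ccrSubalgebra.{v', w} σ').comap (ambientMap T hT) := by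
    refine StarSubalgebra.topologicalClosure_minimal (StarAlgebra.adjoin_le ?_)
      ((StarSubalgebra.isClosed_topologicalClosure _).preimage hc)
    rintro _ ⟨x, rfl⟩
    exact (CCR.W σ' (T x)).2
  exact hle a.2

/-- The ⋆-homomorphism `CCR(V, σ) → CCR(V', σ')`, `W x ↦ W (T x)`, induced by a real linear map `T`
which intertwines the forms. -/
def CCR.map (T : V →ₗ[ℝ] V') (hT : ∀ x y, σ' (T x) (T y) = σ x y) :
    CCR.{v, w} σ →⋆ₐ[ℂ] CCR.{v', w} σ' :=
  ((ambientMap T hT).comp (CCR.incl σ)).codRestrict (ccrSubalgebra σ')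
    (ambientMap_mem T hT)

theorem CCR.map_W (T : V →ₗ[ℝ] V') (hT : ∀ x y, σ' (T x) (T y) = σ x y) (x : V) :
    CCR.map.{v, v', w} T hT (CCR.W σ x) = CCR.W σ' (T x) := rfl

end Weyl

/-! ### States -/

/-- A state of a unital ⋆-algebra: a positive linear functional with value `1` at the unit. -/
structure State (A : Type v) [Ring A] [StarRing A] [Algebra ℂ A] extends A →ₗ[ℂ] ℂ where
  map_one : toFun 1 = 1
  nonneg : ∀ a, 0 ≤ toFun (star a * a)

instance (A : Type v) [Ring A] [StarRing A] [Algebra ℂ A] : CoeFun (State A) fun _ => A → ℂ :=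
  ⟨fun φ => φ.toLinearMap⟩

/-! ### The algebras of one mode, of the Hilbert space, and of the localized elements -/

section Hilbert

variable (E : Type v) [NormedAddCommGroup E] [InnerProductSpace ℂ E]

/-- The canonical symplectic form `σ(x, y) = Im ⟨x, y⟩` of a complex inner product space, with
`⟨·, ·⟩` linear in the first variable; Mathlib's `inner ℂ` is linear in the second one. -/
def imForm : LinearMap.BilinForm ℝ E :=
  LinearMap.mk₂ ℝ (fun x y => (inner ℂ y x : ℂ).im)
    (fun x x' y => by simp)
    (fun r x y => by simp [← Complex.coe_smul])
    (fun x y y' => by simp)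
    (fun r x y => by simp [← Complex.coe_smul, mul_comm])

theorem imForm_apply (x y : E) : imForm E x y = (inner ℂ y x : ℂ).im := rfl

theorem imForm_isAlt : (imForm E).IsAlt := fun x => by
  rw [imForm_apply]; exact inner_self_im (𝕜 := ℂ) x

theorem imForm_complex (z t : ℂ) : imForm ℂ z t = (z * starRingEnd ℂ t).im := by
  simp [imForm_apply]

/-- The Weyl algebra of the real symplectic space underlying `E`. -/
abbrev Weyl : Type (max v (w + 1)) := CCR.{v, w} (imForm E)

/-- The sample algebra `CCR(ℂ, σ)`, `σ(z, t) = Im (z * conj t)`. -/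
abbrev Sample : Type (w + 1) := Weyl.{0, w} ℂ

/-- The characteristic function `G_φ(z) = φ(W(z))` of a state of the sample algebra. -/
def charFn (φ : State Sample.{w}) (z : ℂ) : ℂ := φ (CCR.W (imForm ℂ) z)

variable {E}

/-- The automorphism `ρ_U` of the Weyl algebra with `ρ_U (W x) = W (U x)`, `U` unitary. -/
def rho (U : E ≃ₗᵢ[ℂ] E) : Weyl.{v, w} E →⋆ₐ[ℂ] Weyl.{v, w} E :=
  CCR.map (U.toLinearEquiv.toLinearMap.restrictScalars ℝ) fun x y => by
    simp [imForm_apply]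

theorem rho_W (U : E ≃ₗᵢ[ℂ] E) (x : E) :
    rho.{v, w} U (CCR.W (imForm E) x) = CCR.W (imForm E) (U x) := rfl

variable (e : HilbertBasis ℤ ℂ E)

/-- `ℋ_n`, the span of the basis vectors `e k` with `|k| ≤ n`. -/
def modeSpace (n : ℕ) : Submodule ℂ E := Submodule.span ℂ (e '' {k : ℤ | |k| ≤ n})

/-- `𝔅_n ⊆ CCR(ℋ, σ)`, the C⋆-subalgebra generated by the `W x` with `x ∈ ℋ_n`. -/
def modeAlgebra (n : ℕ) : StarSubalgebra ℂ (Weyl.{v, w} E) :=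
  (StarAlgebra.adjoin ℂ (CCR.W (imForm E) '' (modeSpace e n : Set E))).topologicalClosure

/-- `𝔅₀ ⊆ CCR(ℋ, σ)`, the norm closure of the union of the increasing sequence `𝔅_n`. -/
def localAlgebra : StarSubalgebra ℂ (Weyl.{v, w} E) :=
  (⨆ n, modeAlgebra.{v, w} e n).topologicalClosure

theorem modeSpace_mono : Monotone (modeSpace e) := fun m n h =>
  Submodule.span_mono (Set.image_mono fun k (hk : |k| ≤ (m : ℤ)) =>
    hk.trans (by exact_mod_cast h))

theorem modeAlgebra_mono : Monotone (modeAlgebra.{v, w} e) := fun _ _ h =>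
  StarSubalgebra.topologicalClosure_mono
    (StarAlgebra.adjoin_mono (Set.image_mono (modeSpace_mono e h)))

theorem W_mem_localAlgebra {n : ℕ} {x : E} (hx : x ∈ modeSpace e n) :
    CCR.W (imForm E) x ∈ localAlgebra.{v, w} e :=
  StarSubalgebra.le_topologicalClosure _ (le_iSup (modeAlgebra e) n
    (StarSubalgebra.le_topologicalClosure _
      (StarAlgebra.subset_adjoin ℂ _ (Set.mem_image_of_mem _ hx))))

/-- A closed ⋆-subalgebra which contains the `W x` with `x` localized contains `𝔅₀`. -/
theorem localAlgebra_le {S : StarSubalgebra ℂ (Weyl.{v, w} E)}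
    (hS : IsClosed (S : Set (Weyl.{v, w} E)))
    (h : ∀ n, ∀ x ∈ modeSpace e n, CCR.W (imForm E) x ∈ S) : localAlgebra.{v, w} e ≤ S :=
  StarSubalgebra.topologicalClosure_minimal (iSup_le fun n =>
    StarSubalgebra.topologicalClosure_minimal
      (StarAlgebra.adjoin_le (by rintro _ ⟨x, hx, rfl⟩; exact h n x hx)) hS) hS

/-- The group `𝕌_ℤ` of the unitaries of `ℋ` which fix all but finitely many basis vectors. -/
def localUnitary : Subgroup (E ≃ₗᵢ[ℂ] E) where
  carrier := {U | ∃ N : ℕ, ∀ k : ℤ, (N : ℤ) < |k| → U (e k) = e k}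
  one_mem' := ⟨0, fun _ _ => rfl⟩
  mul_mem' := by
    rintro U U' ⟨N, hN⟩ ⟨N', hN'⟩
    refine ⟨max N N', fun k hk => ?_⟩
    rw [Nat.cast_max, max_lt_iff] at hk
    change U (U' (e k)) = e k
    rw [hN' k hk.2, hN k hk.1]
  inv_mem' := by
    rintro U ⟨N, hN⟩
    exact ⟨N, fun k hk => (LinearIsometryEquiv.symm_apply_eq U).2 (hN k hk).symm⟩

theorem mem_modeSpace_of_inner {n : ℕ} {x : E} (h : ∀ k : ℤ, (n : ℤ) < |k| → inner ℂ (e k) x = 0) :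
    x ∈ modeSpace e n := by
  have hs := e.hasSum_repr x
  have h0 : ∀ k ∉ Finset.Icc (-(n : ℤ)) n, e.repr x k • e k = 0 := by
    intro k hk
    rw [Finset.mem_Icc, ← abs_le, not_le] at hk
    rw [e.repr_apply_apply, h k hk, zero_smul]
  rw [hs.unique (hasSum_sum_of_ne_finset_zero h0)]
  refine Submodule.sum_mem _ fun k hk => Submodule.smul_mem _ _ (Submodule.subset_span ⟨k, ?_, rfl⟩)
  rw [Finset.mem_Icc, ← abs_le] at hk
  exact hk

theorem exists_map_modeSpace {U : E ≃ₗᵢ[ℂ] E} (hU : U ∈ localUnitary e) (n : ℕ) :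
    ∃ m, ∀ x ∈ modeSpace e n, U x ∈ modeSpace e m := by
  obtain ⟨N, hN⟩ := hU
  refine ⟨max n N, fun x hx => mem_modeSpace_of_inner e fun k hk => ?_⟩
  rw [Nat.cast_max, max_lt_iff] at hk
  rw [← hN k hk.2, LinearIsometryEquiv.inner_map_map]
  refine Submodule.span_induction (p := fun y _ => inner ℂ (e k) y = 0) ?_ (inner_zero_right _)
    (fun y z _ _ hy hz => by rw [inner_add_right, hy, hz, add_zero])
    (fun c y _ hy => by rw [inner_smul_right, hy, mul_zero]) hx
  rintro _ ⟨j, hj, rfl⟩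
  refine e.orthonormal.2 fun hkj => ?_
  subst hkj
  exact absurd hj (not_le.2 hk.1)

theorem rho_mem_localAlgebra (U : localUnitary e) (a : localAlgebra.{v, w} e) :
    rho.{v, w} (U : E ≃ₗᵢ[ℂ] E) a ∈ localAlgebra.{v, w} e := by
  have hc : Continuous (rho.{v, w} (U : E ≃ₗᵢ[ℂ] E)) :=
    NonUnitalStarAlgHom.instContinuousLinearMapClassComplex.map_continuous _
  have hle : localAlgebra.{v, w} e ≤ (localAlgebra.{v, w} e).comap (rho (U : E ≃ₗᵢ[ℂ] E)) := by
    refine localAlgebra_le e ((StarSubalgebra.isClosed_topologicalClosure _).preimage hc) ?_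
    intro n x hx
    obtain ⟨m, hm⟩ := exists_map_modeSpace e U.2 n
    exact W_mem_localAlgebra e (hm x hx)
  exact hle a.2

/-- The action `ρ` of `𝕌_ℤ` on `𝔅₀`. -/
def localRho (U : localUnitary e) : localAlgebra.{v, w} e →⋆ₐ[ℂ] localAlgebra.{v, w} e :=
  ((rho (U : E ≃ₗᵢ[ℂ] E)).comp (localAlgebra e).subtype).codRestrict (localAlgebra e)
    (rho_mem_localAlgebra e U)

/-- A state `ω` of `𝔅₀` is `𝕌_ℤ`-invariant if `ω ∘ ρ_U = ω` for all `U ∈ 𝕌_ℤ`. -/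
def IsUnitaryInvariant (ω : State (localAlgebra.{v, w} e)) : Prop :=
  ∀ (U : localUnitary e) (a : localAlgebra.{v, w} e), ω (localRho e U a) = ω a

/-- The real linear map `ℂ → ℋ`, `z ↦ z • e k`. -/
def modeMap (k : ℤ) : ℂ →ₗ[ℝ] E := (LinearMap.toSpanSingleton ℂ E (e k)).restrictScalars ℝ

theorem imForm_modeMap (k : ℤ) (z t : ℂ) :
    imForm E (modeMap e k z) (modeMap e k t) = imForm ℂ z t := by
  have h : ‖e k‖ = 1 := e.orthonormal.1 k
  simp [imForm_apply, modeMap, h]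

theorem map_modeMap_mem (k : ℤ) (a : Sample.{w}) :
    CCR.map.{0, v, w} (modeMap e k) (imForm_modeMap e k) a ∈ localAlgebra.{v, w} e := by
  have hc : Continuous (CCR.map.{0, v, w} (modeMap e k) (imForm_modeMap e k)) :=
    NonUnitalStarAlgHom.instContinuousLinearMapClassComplex.map_continuous _
  refine CCR.mem_of_W (S := (localAlgebra.{v, w} e).comap (CCR.map _ (imForm_modeMap e k)))
    ((StarSubalgebra.isClosed_topologicalClosure _).preimage hc) (fun z => ?_) a
  refine W_mem_localAlgebra e (n := k.natAbs) (Submodule.smul_mem _ z (Submodule.subset_span ?_))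
  exact ⟨k, by simp, rfl⟩

/-- The `k`-th embedding `i_k` of the sample algebra into `𝔅₀ ≅ ⨂_ℤ CCR(ℂ, σ)`,
`i_k (W z) = W (z • e k)`. -/
def modeEmbed (k : ℤ) : Sample.{w} →⋆ₐ[ℂ] localAlgebra.{v, w} e :=
  (CCR.map (modeMap e k) (imForm_modeMap e k)).codRestrict (localAlgebra e) (map_modeMap_mem e k)

theorem modeEmbed_W (k : ℤ) (z : ℂ) :
    (modeEmbed.{v, w} e k (CCR.W (imForm ℂ) z) : Weyl.{v, w} E) = CCR.W (imForm E) (z • e k) := rfl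

/-- `ω = ⨂_ℤ φ`: the state `ω` of `𝔅₀ ≅ ⨂_ℤ CCR(ℂ, σ)` takes the value `φ(a₁) ⋯ φ(aₙ)` at the
localized tensor `i_{k₁}(a₁) ⋯ i_{kₙ}(aₙ)`, for distinct sites `k₁, …, kₙ`. -/
def IsProductState (φ : State Sample.{w}) (ω : State (localAlgebra.{v, w} e)) : Prop :=
  ∀ (l : List ℤ), l.Nodup → ∀ a : ℤ → Sample.{w},
    ω ((l.map fun k => modeEmbed e k (a k)).prod) = (l.map fun k => φ (a k)).prod

end Hilbert

end CCRAlg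

end

namespace CCRAlg

open scoped ComplexOrder

/-! Unitary invariance forces `charFn φ z * charFn φ t = charFn φ r` whenever |r|² = |z|² + |t|²
(`charFn_mul_charFn`): a local unitary carries the vector z e₀ + t e₁ to r e₂, and the product state
splits over modes. Taking t = 0 makes the characteristic function radial, so g(|z|²) = `charFn φ z`
is multiplicative on [0, ∞). This is Maxwell's characterization of the Gaussian. Continuity is not
assumed; the bounds 0 ≤ g ≤ 1, which come from positivity of φ, replace it and leave only two cases:
g vanishes on (0, ∞), or g(s) = exp(-c s) (`eq_zero_or_exp_of_multiplicative`). Positivity alone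
would allow any c ≥ 0 in a commutative algebra; the Weyl phases are what give 2c ≥ 1
(`half_le_of_charFn_eq_exp`). -/

/-! ### Cauchy's functional equation on the half-line -/

/-- A nonnegative additive function on `[0, ∞)` is linear. -/
theorem eq_mul_of_additive_nonneg {f : ℝ → ℝ}
    (hadd : ∀ s t, 0 ≤ s → 0 ≤ t → f (s + t) = f s + f t) (hf : ∀ t, 0 ≤ t → 0 ≤ f t)
    {t : ℝ} (ht : 0 ≤ t) : f t = t * f 1 := by
  have h0 : f 0 = 0 := by have := hadd 0 0 le_rfl le_rfl; simp at this; exact this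
  have hn : ∀ (n : ℕ) (s : ℝ), 0 ≤ s → f (n * s) = n * f s := by
    intro n s hs
    induction n with
    | zero => simp [h0]
    | succ n ih =>
      rw [Nat.cast_succ, add_mul, one_mul, hadd _ _ (by positivity) hs, ih]; ring
  have hmono : ∀ s u, 0 ≤ s → s ≤ u → f s ≤ f u := by
    intro s u hs hu
    have h1 := hadd s (u - s) hs (by linarith)
    have h2 := hf (u - s) (by linarith)
    rw [add_sub_cancel] at h1
    linarith
  have hbound : ∀ n : ℕ, (n : ℝ) * |f t - t * f 1| ≤ f 1 := by
    intro n
    have hnt : 0 ≤ (n : ℝ) * t := by positivity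
    have hl := Nat.floor_le hnt
    have hu := (Nat.lt_floor_add_one ((n : ℝ) * t)).le
    -- By monotonicity `f (n * t)` lies between `m * f 1` and `(m + 1) * f 1`, and so does `n * t *
    -- f 1`; their distance is at most `f 1`, uniformly in `n`.
    set m := ⌊(n : ℝ) * t⌋₊
    have e1 := hmono _ _ (by positivity) hl
    have e2 := hmono _ _ hnt hu
    rw [hn n t ht] at e1 e2
    have e3 := hn m 1 zero_le_one
    have e4 := hn (m + 1) 1 zero_le_one
    rw [mul_one] at e3 e4
    push_cast at e4
    rw [e3] at e1
    rw [e4] at e2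
    have h1 := hf 1 zero_le_one
    have : (n : ℝ) * |f t - t * f 1| = |n * f t - n * t * f 1| := by
      rw [← abs_of_nonneg (Nat.cast_nonneg (α := ℝ) n), ← abs_mul,
        abs_of_nonneg (Nat.cast_nonneg (α := ℝ) n)]
      ring_nf
    rw [this, abs_le]
    constructor <;> nlinarith
  by_contra hne
  have hpos : 0 < |f t - t * f 1| := abs_pos.2 (sub_ne_zero.2 hne)
  obtain ⟨n, hn'⟩ := exists_nat_gt (f 1 / |f t - t * f 1|)
  rw [div_lt_iff₀ hpos] at hn'
  exact absurd (hbound n) (not_le.2 hn')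

/-- A multiplicative function `[0, ∞) → [0, 1]` which vanishes at some point vanishes on
`(0, ∞)`, and otherwise it is an exponential. -/
theorem eq_zero_or_exp_of_multiplicative {g : ℝ → ℝ}
    (hmul : ∀ s t, 0 ≤ s → 0 ≤ t → g (s + t) = g s * g t)
    (h0 : ∀ t, 0 ≤ t → 0 ≤ g t) (h1 : ∀ t, 0 ≤ t → g t ≤ 1) :
    (∀ t, 0 < t → g t = 0) ∨ ∃ c : ℝ, ∀ t, 0 ≤ t → g t = Real.exp (-(c * t)) := by
  by_cases hz : ∃ s, 0 ≤ s ∧ g s = 0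
  · left
    obtain ⟨s, hs, hgs⟩ := hz
    intro t ht
    have hpow : ∀ n : ℕ, g (n * t) = 0 → n ≠ 0 → g t = 0 := by
      intro n
      induction n with
      | zero => intro _ h; exact absurd rfl h
      | succ n ih =>
        intro h _
        rw [Nat.cast_succ, add_mul, one_mul, hmul _ _ (by positivity) ht.le] at h
        rcases mul_eq_zero.1 h with h | h
        · rcases eq_or_ne n 0 with rfl | hn
          · have := hmul 0 t le_rfl ht.le
            simp only [Nat.cast_zero, zero_mul] at h
            rw [h, zero_mul, zero_add] at this
            exact this
          · exact ih h hn
        · exact h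
    -- A zero at `s` propagates to every larger argument, hence to some `n * t`, where `g` is the
    -- `n`-th power of `g t`.
    obtain ⟨n, hn⟩ := exists_nat_gt (s / t)
    rw [div_lt_iff₀ ht] at hn
    refine hpow n ?_ ?_
    · have := hmul s (n * t - s) hs (by linarith)
      rw [add_sub_cancel, hgs, zero_mul] at this
      exact this
    · rintro rfl
      simp at hn
      linarith
  · right
    push Not at hz
    have hpos : ∀ t, 0 ≤ t → 0 < g t := fun t ht => (h0 t ht).lt_of_ne' (hz t ht)
    refine ⟨-Real.log (g 1), fun t ht => ?_⟩
    have := eq_mul_of_additive_nonneg (f := fun t => -Real.log (g t))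
      (fun s t hs ht => by
        simp only [hmul s t hs ht, Real.log_mul (hz s hs) (hz t ht)]; ring)
      (fun t ht => by simpa using Real.log_nonpos (h0 t ht) (h1 t ht)) ht
    rw [show -(-Real.log (g 1) * t) = Real.log (g t) by linarith, Real.exp_log (hpos t ht)]

/-! ### A unitary exchanging two orthogonal vectors -/

section Reflection

variable {E : Type*} [NormedAddCommGroup E] [InnerProductSpace ℂ E]

/-- The reflection in the orthogonal complement of `x - y` exchanges orthogonal vectors `x`, `y`
of equal norm. -/
theorem reflection_orthogonal_sub {x y : E} (hxy : inner ℂ x y = 0) (hn : ‖x‖ = ‖y‖) :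
    (Submodule.span ℂ {x - y})ᗮ.reflection x = y := by
  have hyx : inner ℂ y x = 0 := inner_eq_zero_symm.1 hxy
  -- Equal norms and orthogonality make x + y orthogonal to x - y, so the reflection fixes the sum
  -- and negates the difference.
  have hs : x + y ∈ (Submodule.span ℂ {x - y})ᗮ := by
    rw [Submodule.mem_orthogonal_singleton_iff_inner_right]
    simp [inner_sub_left, inner_add_right, hxy, hyx, inner_self_eq_norm_sq_to_K, hn]
  have h1 := Submodule.reflection_mem_subspace_eq_self hs
  have h2 : (Submodule.span ℂ {x - y})ᗮ.reflection (x - y) = -(x - y) :=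
    Submodule.reflection_mem_subspace_orthogonal_precomplement_eq_neg
      (Submodule.mem_span_singleton_self _)
  have h3 : (2 : ℂ) • x = (x + y) + (x - y) := by rw [two_smul]; abel
  have h4 : (2 : ℂ) • (Submodule.span ℂ {x - y})ᗮ.reflection x = (2 : ℂ) • y := by
    rw [← map_smul, h3, map_add, h1, h2, two_smul]; abel
  exact smul_right_injective E two_ne_zero h4

end Reflection

/-! ### Positivity of characteristic functions and the uncertainty bound -/

section CharFn

variable (φ : State Sample.{w})

theorem charFn_zero : charFn φ 0 = 1 := by
  rw [charFn, CCR.W_zero]; exact φ.map_one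

/-- Positivity of the state at a linear combination of Weyl elements. -/
theorem charFn_twisted_nonneg {ι : Type*} (s : Finset ι) (c : ι → ℂ) (z : ι → ℂ) :
    0 ≤ ∑ j ∈ s, ∑ k ∈ s, starRingEnd ℂ (c j) * c k *
      Complex.exp (Complex.I * (imForm ℂ (-z j) (z k) : ℂ)) * charFn φ (z k - z j) := by
  have h := φ.nonneg (∑ j ∈ s, c j • CCR.W (imForm ℂ) (z j))
  have h' : φ (star (∑ j ∈ s, c j • CCR.W (imForm ℂ) (z j)) *
      ∑ j ∈ s, c j • CCR.W (imForm ℂ) (z j)) = ∑ j ∈ s, ∑ k ∈ s, starRingEnd ℂ (c j) * c k *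
      Complex.exp (Complex.I * (imForm ℂ (-z j) (z k) : ℂ)) * charFn φ (z k - z j) := by
    rw [star_sum, Finset.sum_mul_sum, map_sum]
    refine Finset.sum_congr rfl fun j _ => ?_
    rw [map_sum]
    refine Finset.sum_congr rfl fun k _ => ?_
    rw [star_smul, CCR.star_W, smul_mul_smul_comm, CCR.W_mul, smul_smul, map_smul, smul_eq_mul,
      charFn, neg_add_eq_sub]
    rfl
  rw [← h']
  exact h

theorem charFn_pair_nonneg (c z : ℂ) :
    0 ≤ 1 + starRingEnd ℂ c * c + c * charFn φ z + starRingEnd ℂ c * charFn φ (-z) := by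
  have h := charFn_twisted_nonneg φ Finset.univ ![1, c] ![0, z]
  have h0 : imForm ℂ z z = 0 := imForm_isAlt ℂ z
  simp [Fin.sum_univ_two, charFn_zero, h0] at h
  convert h using 1
  ring

/-- The pair inequality also says that its right side is real; the weights 1 and i give the
imaginary and real parts of the identity. -/
theorem charFn_neg (z : ℂ) : charFn φ (-z) = starRingEnd ℂ (charFn φ z) := by
  have h1 := charFn_pair_nonneg φ 1 z
  have h2 := charFn_pair_nonneg φ Complex.I z
  rw [Complex.le_def] at h1 h2
  have h1 := h1.2
  have h2 := h2.2
  simp at h1 h2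
  apply Complex.ext <;> simp <;> linarith

theorem norm_charFn_le (z : ℂ) : ‖charFn φ z‖ ≤ 1 := by
  -- This weight minimizes the quadratic expression, leaving 1 - |G|² ≥ 0.
  have h := charFn_pair_nonneg φ (-starRingEnd ℂ (charFn φ z)) z
  rw [charFn_neg, Complex.le_def] at h
  have h := h.1
  have h2 := Complex.sq_norm (charFn φ z)
  rw [Complex.normSq_apply] at h2
  simp at h
  have : ‖charFn φ z‖ ^ 2 ≤ 1 := by linarith
  nlinarith [norm_nonneg (charFn φ z)]

/-- The uncertainty principle for a Gaussian characteristic function: positivity at the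
combination `∑ j, i ^ j W (i ^ j r)`. -/
theorem two_mul_exp_mul_sin_le {c : ℝ}
    (hG : ∀ z : ℂ, charFn φ z = (Real.exp (-(c * ‖z‖ ^ 2)) : ℂ)) {s : ℝ} (hs : 0 ≤ s) :
    2 * Real.exp (-(2 * c * s)) * Real.sin s ≤ 1 - Real.exp (-(4 * c * s)) := by
  have hr : √s * √s = s := Real.mul_self_sqrt hs
  -- With weights iʲ at the points iʲ√s, each term depends only on m = k - j mod 4. The terms m = ±1
  -- add up to -2 exp(-2cs) sin s and m = 2 gives -exp(-4cs), so the sum is four times the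
  -- difference of the two sides.
  have h := charFn_twisted_nonneg φ Finset.univ ![1, Complex.I, -1, -Complex.I]
    ![√s, Complex.I * √s, -√s, -(Complex.I * √s)]
  rw [Complex.le_def] at h
  have h := h.1
  have e1 : (Complex.exp (Complex.I * (√s * √s))).im = Real.sin s := by
    rw [← Complex.ofReal_mul, hr, mul_comm, Complex.exp_ofReal_mul_I_im]
  have e2 : (Complex.exp (-(Complex.I * (√s * √s)))).im = -Real.sin s := by
    rw [← Complex.ofReal_mul, hr, mul_comm, ← neg_mul, ← Complex.ofReal_neg,
      Complex.exp_ofReal_mul_I_im, Real.sin_neg]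
  have e3 : (-√s - √s) * (-√s - √s) = 4 * s := by linear_combination 4 * hr
  have e4 : (√s + √s) * (√s + √s) = 4 * s := by linear_combination 4 * hr
  simp [Fin.sum_univ_four, hG, imForm_complex, Complex.sq_norm, Complex.normSq_apply, hr,
    -Complex.ofReal_exp, e1, e2, e3, e4] at h
  rw [show 2 * c * s = c * (s + s) by ring, show 4 * c * s = c * (4 * s) by ring]
  linarith

/-- Both sides of the preceding inequality vanish at s = 0, so their difference has nonnegative
right derivative there, namely 4c - 2. -/
theorem half_le_of_charFn_eq_exp {c : ℝ}
    (hG : ∀ z : ℂ, charFn φ z = (Real.exp (-(c * ‖z‖ ^ 2)) : ℂ)) : 1 ≤ 2 * c := by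
  have h := fun s (hs : 0 ≤ s) => two_mul_exp_mul_sin_le φ hG hs
  have hd : HasDerivAt (fun s : ℝ => 1 - Real.exp (-(4 * c * s)) -
      2 * Real.exp (-(2 * c * s)) * Real.sin s) (4 * c - 2) 0 := by
    have hlin : ∀ b : ℝ, HasDerivAt (fun s : ℝ => Real.exp (-(b * s))) (-b) 0 := fun b => by
      have := (((hasDerivAt_id (0 : ℝ)).const_mul b).neg).exp
      simpa using this
    have := ((hlin (4 * c)).const_sub 1).sub
      (((hlin (2 * c)).const_mul 2).mul (Real.hasDerivAt_sin 0))
    refine HasDerivAt.congr_deriv this ?_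
    simp
  have hnn : 0 ≤ 4 * c - 2 := by
    refine ge_of_tendsto (hd.tendsto_slope_zero_right) ?_
    filter_upwards [self_mem_nhdsWithin] with s hs
    have hs' : (0 : ℝ) < s := hs
    have := h s hs'.le
    simp only [zero_add, mul_zero, neg_zero, Real.exp_zero, Real.sin_zero, sub_self, sub_zero,
      smul_eq_mul]
    exact mul_nonneg (inv_nonneg.2 hs'.le) (by linarith)
  linarith

end CharFn

/-! ### Multiplicativity from unitary invariance -/

section Product

variable {E : Type v} [NormedAddCommGroup E] [InnerProductSpace ℂ E] {e : HilbertBasis ℤ ℂ E}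
  {φ : State Sample.{w}} {ω : State (localAlgebra.{v, w} e)}

theorem IsProductState.apply_modeEmbed (h : IsProductState e φ ω) (k : ℤ) (a : Sample.{w}) :
    ω (modeEmbed e k a) = φ a := by
  simpa using h [k] (List.nodup_singleton k) fun _ => a

theorem IsProductState.apply_mul (h : IsProductState e φ ω) {j k : ℤ} (hjk : j ≠ k)
    (a b : Sample.{w}) : ω (modeEmbed e j a * modeEmbed e k b) = φ a * φ b := by
  have := h [j, k] (by simp [hjk]) fun i => if i = j then a else b
  simpa [hjk.symm] using this

/-- Invariance under the reflection which exchanges `z e₀ + t e₁` with a multiple of `e₂`. -/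
theorem charFn_mul_charFn (hprod : IsProductState e φ ω) (hinv : IsUnitaryInvariant e ω)
    {z t r : ℂ} (hr : ‖r‖ ^ 2 = ‖z‖ ^ 2 + ‖t‖ ^ 2) :
    charFn φ z * charFn φ t = charFn φ r := by
  have he := orthonormal_iff_ite.1 e.orthonormal
  set x : E := z • e 0 + t • e 1 with hx
  -- A third mode makes the target orthogonal to the source whatever the phase of `r`, so a single
  -- reflection suffices.
  set y : E := r • e 2 with hy
  have hxy : inner ℂ x y = 0 := by
    simp [hx, hy, he]
  have hn : ‖x‖ = ‖y‖ := by
    have h1 : ‖x‖ ^ 2 = ‖y‖ ^ 2 := by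
      have h01 : inner ℂ (z • e 0) (t • e 1) = 0 := by
        simp [he]
      have := norm_add_sq_eq_norm_sq_add_norm_sq_of_inner_eq_zero (𝕜 := ℂ) _ _ h01
      rw [← hx] at this
      simp only [norm_smul, e.orthonormal.1, mul_one] at this
      rw [hy, norm_smul, e.orthonormal.1, mul_one, hr]
      nlinarith
    exact (sq_eq_sq₀ (norm_nonneg _) (norm_nonneg _)).1 h1
  set U : E ≃ₗᵢ[ℂ] E := (Submodule.span ℂ {x - y})ᗮ.reflection with hU
  have hUmem : U ∈ localUnitary e := by
    refine ⟨2, fun k hk => Submodule.reflection_mem_subspace_eq_self ?_⟩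
    rw [Submodule.mem_orthogonal_singleton_iff_inner_right]
    have h0 : (0 : ℤ) ≠ k := by rintro rfl; simp at hk
    have h1 : (1 : ℤ) ≠ k := by rintro rfl; simp at hk
    have h2 : (2 : ℤ) ≠ k := by rintro rfl; simp at hk
    simp [hx, hy, inner_sub_left, inner_add_left, inner_smul_left, he, h0, h1, h2]
  have hW : localRho e ⟨U, hUmem⟩ (modeEmbed e 0 (CCR.W (imForm ℂ) z) *
      modeEmbed e 1 (CCR.W (imForm ℂ) t)) = modeEmbed e 2 (CCR.W (imForm ℂ) r) := by
    apply Subtype.ext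
    change rho U (CCR.W (imForm E) (z • e 0) * CCR.W (imForm E) (t • e 1)) =
      CCR.W (imForm E) (r • e 2)
    -- Distinct modes are orthogonal, so the Weyl product carries no phase.
    have h0 : imForm E (z • e 0) (t • e 1) = 0 := by
      simp [imForm_apply, he]
    rw [CCR.W_mul, h0, Complex.ofReal_zero, mul_zero, Complex.exp_zero, one_smul, rho_W, ← hx,
      hU, reflection_orthogonal_sub hxy hn]
  have := hinv ⟨U, hUmem⟩ (modeEmbed e 0 (CCR.W (imForm ℂ) z) *
      modeEmbed e 1 (CCR.W (imForm ℂ) t))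
  rw [hW, hprod.apply_modeEmbed, hprod.apply_mul zero_ne_one] at this
  exact this.symm

end Product

end CCRAlg

/-! ### The dichotomy -/

theorem proposition3p9 {H : Type u} [NormedAddCommGroup H] [InnerProductSpace ℂ H]
    [CompleteSpace H] (e : HilbertBasis ℤ ℂ H)
    (φ : CCRAlg.State CCRAlg.Sample.{u}) (ω : CCRAlg.State (CCRAlg.localAlgebra.{u, u} e))
    (hprod : CCRAlg.IsProductState e φ ω) (hinv : CCRAlg.IsUnitaryInvariant e ω) :
    CCRAlg.charFn φ = Set.indicator {0} 1 ∨
      ∃ σsq : ℝ, 1 ≤ σsq ∧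
        ∀ z : ℂ, CCRAlg.charFn φ z = (Real.exp (-(σsq * ‖z‖ ^ 2) / 2) : ℂ) := by
  have hmul : ∀ z t r : ℂ, ‖r‖ ^ 2 = ‖z‖ ^ 2 + ‖t‖ ^ 2 →
      CCRAlg.charFn φ z * CCRAlg.charFn φ t = CCRAlg.charFn φ r :=
    fun z t r hr => CCRAlg.charFn_mul_charFn hprod hinv hr
  have hrad : ∀ z r : ℂ, ‖r‖ ^ 2 = ‖z‖ ^ 2 → CCRAlg.charFn φ z = CCRAlg.charFn φ r :=
    fun z r hr => by simpa [CCRAlg.charFn_zero] using hmul z 0 r (by simpa using hr)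
  -- Radiality identifies the values at z and -z, which are complex conjugates.
  have hreal : ∀ z, CCRAlg.charFn φ z = ((CCRAlg.charFn φ z).re : ℂ) := fun z => by
    refine (Complex.conj_eq_iff_re.1 ?_).symm
    rw [← CCRAlg.charFn_neg]
    exact hrad _ _ (by simp)
  set g : ℝ → ℝ := fun s => (CCRAlg.charFn φ (√s : ℝ)).re with hg
  have hsq : ∀ s : ℝ, 0 ≤ s → ‖((√s : ℝ) : ℂ)‖ ^ 2 = s := fun s hs => by
    rw [Complex.norm_real, Real.norm_eq_abs, sq_abs, Real.sq_sqrt hs]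
  have hGg : ∀ z : ℂ, CCRAlg.charFn φ z = (g (‖z‖ ^ 2) : ℂ) := fun z => by
    rw [hg, ← hreal]
    exact hrad _ _ (hsq _ (by positivity))
  have hgmul : ∀ s t, 0 ≤ s → 0 ≤ t → g (s + t) = g s * g t := by
    intro s t hs ht
    have h := hmul (√s : ℝ) (√t : ℝ) (√(s + t) : ℝ) (by
      rw [hsq s hs, hsq t ht, hsq _ (add_nonneg hs ht)])
    rw [hreal (√s : ℝ), hreal (√t : ℝ), hreal (√(s + t) : ℝ)] at h
    exact_mod_cast h.symm
  -- Each value is the square of the real value at half the argument.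
  have hg0 : ∀ t, 0 ≤ t → 0 ≤ g t := fun t ht => by
    have := hgmul (t / 2) (t / 2) (by positivity) (by positivity)
    rw [add_halves] at this
    rw [this]
    exact mul_self_nonneg _
  have hg1 : ∀ t, 0 ≤ t → g t ≤ 1 := fun t _ =>
    (Complex.re_le_norm _).trans (CCRAlg.norm_charFn_le φ _)
  rcases CCRAlg.eq_zero_or_exp_of_multiplicative hgmul hg0 hg1 with h | ⟨c, hc⟩
  · left
    funext z
    rcases eq_or_ne z 0 with rfl | hz
    · simp [CCRAlg.charFn_zero]
    · rw [hGg, h _ (by positivity)]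
      simp [hz]
  · right
    have hG : ∀ z : ℂ, CCRAlg.charFn φ z = (Real.exp (-(c * ‖z‖ ^ 2)) : ℂ) := fun z => by
      rw [hGg, hc _ (by positivity)]
    refine ⟨2 * c, CCRAlg.half_le_of_charFn_eq_exp φ hG, fun z => ?_⟩
    rw [hG]
    congr 3
    ring
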